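/- Let $a,b\ge 1$ and $r\ge 0$ be integers. For positive integers $c,d$ with $cd=ab$, let $\phi^{(c^d)}$ be the character of the permutation module over $\mathbb{C}$ of the symmetric group $S_{ab}$ (the Foulkes module) on the set partitions of $\{1,\dots,ab\}$ into $d$ sets each of size $c$. For a finite sequence $\mu$ of non-negative integers with sum $ab$, let $\pi^{\mu}$ be the character of the Young permutation module $M^\mu$ over $\mathbb{C}$, which has the $\mu$-tabloids as basis, and let $\chi^\mu$ be the character of the Specht module $S^\mu\subseteq M^\mu$ spanned by the $\mu$-polytabloids. Write $\langle\cdot,\cdot\rangle$ for the usual inner product of characters of $S_{ab}$. Let $P(r)_a^b$ be the set of partitions of $r$ with at most $b$ parts and all parts at most $a$, and put $P(-1)_a^b=\emptyset$. Then: (i) if $r\le ab$, then $$\langle\phi^{(a^b)},\pi^{(ab-r,r)}\rangle=\langle\phi^{(b^a)},\pi^{(ab-r,r)}\rangle=|P(r)_a^b|;$$ (ii) if $2r\le ab$ (so that $(ab-r,r)$ is a partition of $ab$), then $$\langle\phi^{(a^b)},\chi^{(ab-r,r)}\rangle=\langle\phi^{(b^a)},\chi^{(ab-r,r)}\rangle=|P(r)_a^b|-|P(r-1)_a^b|.$$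 -/

import Mathlib

open scoped Pointwise

noncomputable section

namespace Foulkes

/-- The inner product `(1 / |G|) ∑ g, φ g * conj (ψ g)` of complex class functions. -/
def charInner {G : Type*} [Group G] [Fintype G] (φ ψ : G → ℂ) : ℂ :=
  (Fintype.card G : ℂ)⁻¹ * ∑ g : G, φ g * (starRingEnd ℂ) (ψ g)

/-! ### The Foulkes module -/

/-- The set partitions of `{0, …, n - 1}` into `b` sets, each of size `a`
(none exist unless `n = a * b`). -/
def SetPartition (n a b : ℕ) : Type :=
  {P : Finset (Finset (Fin n)) //
    P.card = b ∧ (∀ A ∈ P, A.card = a) ∧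
      (∀ A ∈ P, ∀ B ∈ P, A ≠ B → Disjoint A B) ∧ ∀ x, ∃ A ∈ P, x ∈ A}

/-- A permutation acts on set partitions by moving the elements of each block. -/
instance (n a b : ℕ) : MulAction (Equiv.Perm (Fin n)) (SetPartition n a b) where
  smul σ P := ⟨σ • P.1, by
    obtain ⟨h1, h2, h3, h4⟩ := P.2
    refine ⟨by rw [Finset.card_smul_finset, h1], ?_, ?_, ?_⟩
    · intro A' hA'
      obtain ⟨A, hA, rfl⟩ := Finset.mem_smul_finset.1 hA'
      rw [Finset.card_smul_finset, h2 A hA]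
    · intro A' hA' B' hB' hAB
      obtain ⟨A, hA, rfl⟩ := Finset.mem_smul_finset.1 hA'
      obtain ⟨B, hB, rfl⟩ := Finset.mem_smul_finset.1 hB'
      have hd := h3 A hA B hB (fun h => hAB (by rw [h]))
      rw [Finset.disjoint_left] at hd ⊢
      intro x hx hx'
      rw [← Finset.inv_smul_mem_iff] at hx hx'
      exact hd hx hx'
    · intro x
      obtain ⟨A, hA, hx⟩ := h4 (σ⁻¹ • x)
      exact ⟨σ • A, Finset.smul_mem_smul_finset hA,
        Finset.inv_smul_mem_iff.1 hx⟩⟩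
  one_smul P := Subtype.ext (one_smul _ P.1)
  mul_smul σ τ P := Subtype.ext (mul_smul σ τ P.1)

/-- The Foulkes module: the permutation module over `ℂ` on the set partitions of an `n`-element
set into `b` sets of size `a`. -/
def foulkesModule (n a b : ℕ) :
    Representation ℂ (Equiv.Perm (Fin n)) (MonoidAlgebra ℂ (SetPartition n a b)) :=
  Representation.ofMulAction ℂ (Equiv.Perm (Fin n)) (SetPartition n a b)

/-- The Foulkes character, i.e. the character of the Foulkes module. -/
def foulkesCharacter (n a b : ℕ) : Equiv.Perm (Fin n) → ℂ :=
  (foulkesModule n a b).character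

/-! ### Tableaux, tabloids, Young permutation modules and Specht modules

A shape is a sequence `μ : Fin k → ℕ` of row lengths; its cells are the pairs `⟨i, j⟩` with
`j < μ i`, in row `i` and column `j`. -/

/-- A tableau of shape `μ`: a bijective filling of the cells with `{0, …, n - 1}`. -/
def Tableau (n : ℕ) {k : ℕ} (μ : Fin k → ℕ) : Type :=
  (Σ i : Fin k, Fin (μ i)) ≃ Fin n

namespace Tableau

variable {n k : ℕ} {μ : Fin k → ℕ}

/-- The row of `t` that contains the entry `x`. -/
def row (t : Tableau n μ) (x : Fin n) : Fin k := (Equiv.symm t x).1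

/-- The column of `t` that contains the entry `x`. -/
def col (t : Tableau n μ) (x : Fin n) : ℕ := (Equiv.symm t x).2

/-- A permutation acts on tableaux by replacing each entry `x` by `σ x`. -/
instance : MulAction (Equiv.Perm (Fin n)) (Tableau n μ) where
  smul σ t := Equiv.trans t σ
  one_smul _ := rfl
  mul_smul _ _ _ := rfl

theorem row_smul (σ : Equiv.Perm (Fin n)) (t : Tableau n μ) (x : Fin n) :
    (σ • t).row x = t.row (σ⁻¹ x) := rfl

theorem col_smul (σ : Equiv.Perm (Fin n)) (t : Tableau n μ) (x : Fin n) :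
    (σ • t).col x = t.col (σ⁻¹ x) := rfl

/-- Two tableaux are row equivalent if each row of the first has the same entries as the same row
of the second. -/
instance rowEquivalent (n : ℕ) {k : ℕ} (μ : Fin k → ℕ) : Setoid (Tableau n μ) where
  r t u := ∀ x, t.row x = u.row x
  iseqv := ⟨fun _ _ => rfl, fun h x => (h x).symm, fun h h' x => (h x).trans (h' x)⟩

/-- The column stabilizer of `t`: the permutations that preserve each column of `t`. -/
def columnStabilizer (t : Tableau n μ) : Subgroup (Equiv.Perm (Fin n)) where
  carrier := {π | ∀ x, t.col (π x) = t.col x}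
  one_mem' _ := rfl
  mul_mem' {π π'} h h' x := (h (π' x)).trans (h' x)
  inv_mem' {π} h x := by
    simpa using (h (π⁻¹ x)).symm

theorem mem_columnStabilizer {t : Tableau n μ} {π : Equiv.Perm (Fin n)} :
    π ∈ t.columnStabilizer ↔ ∀ x, t.col (π x) = t.col x := Iff.rfl

instance (t : Tableau n μ) : DecidablePred (· ∈ t.columnStabilizer) :=
  fun _ => decidable_of_iff' _ mem_columnStabilizer

end Tableau

/-- A tabloid of shape `μ`: a row equivalence class of tableaux. -/
def Tabloid (n : ℕ) {k : ℕ} (μ : Fin k → ℕ) : Type :=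
  Quotient (Tableau.rowEquivalent n μ)

variable {n k : ℕ} {μ : Fin k → ℕ}

/-- The tabloid `{t}` of a tableau `t`. -/
def Tableau.toTabloid (t : Tableau n μ) : Tabloid n μ :=
  Quotient.mk _ t

/-- The action of the symmetric group on tabloids, `σ • {t} = {σ • t}`. -/
instance : MulAction (Equiv.Perm (Fin n)) (Tabloid n μ) where
  smul σ := Quotient.map (σ • ·) fun _ _ h x => h (σ⁻¹ x)
  one_smul := by rintro ⟨t⟩; rfl
  mul_smul := by rintro σ τ ⟨t⟩; rfl

theorem smul_toTabloid (σ : Equiv.Perm (Fin n)) (t : Tableau n μ) :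
    σ • t.toTabloid = (σ • t).toTabloid := rfl

/-- The Young permutation module `M^μ`: the permutation module over `ℂ` on the `μ`-tabloids. -/
def youngModule (n : ℕ) {k : ℕ} (μ : Fin k → ℕ) :
    Representation ℂ (Equiv.Perm (Fin n)) (MonoidAlgebra ℂ (Tabloid n μ)) :=
  Representation.ofMulAction ℂ (Equiv.Perm (Fin n)) (Tabloid n μ)

/-- The Young permutation character `π^μ`, i.e. the character of `M^μ`. -/
def youngCharacter (n : ℕ) {k : ℕ} (μ : Fin k → ℕ) : Equiv.Perm (Fin n) → ℂ :=
  (youngModule n μ).character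

/-- The polytabloid `e_t = ∑ sgn(π) {π • t}`, summed over the column stabilizer of `t`. -/
def Tableau.polytabloid (t : Tableau n μ) : MonoidAlgebra ℂ (Tabloid n μ) :=
  ∑ π : t.columnStabilizer,
    MonoidAlgebra.single ((π : Equiv.Perm (Fin n)) • t).toTabloid
      ((Equiv.Perm.sign (π : Equiv.Perm (Fin n)) : ℤ) : ℂ)

theorem youngModule_polytabloid (σ : Equiv.Perm (Fin n)) (t : Tableau n μ) :
    youngModule n μ σ t.polytabloid = (σ • t).polytabloid := by
  have key : ∀ π, π ∈ t.columnStabilizer ↔ MulAut.conj σ π ∈ (σ • t).columnStabilizer := by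
    intro π
    simp only [Tableau.mem_columnStabilizer, Tableau.col_smul, MulAut.conj_apply,
      Equiv.Perm.mul_apply]
    exact ⟨fun h x => by simpa using h (σ⁻¹ x), fun h x => by simpa using h (σ x)⟩
  rw [Tableau.polytabloid, Tableau.polytabloid, map_sum]
  refine Fintype.sum_equiv ((MulAut.conj σ).toEquiv.subtypeEquiv key) _ _ fun π => ?_
  rw [youngModule, Representation.ofMulAction_single]
  have hs : Equiv.Perm.sign (σ * (π : Equiv.Perm (Fin n)) * σ⁻¹) = Equiv.Perm.sign (π : Equiv.Perm (Fin n)) := by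
    rw [Equiv.Perm.sign_mul, Equiv.Perm.sign_mul, Equiv.Perm.sign_inv, mul_right_comm,
      Int.units_mul_self, one_mul]
  simp [-Equiv.Perm.sign_mul, -map_mul, hs, smul_toTabloid, smul_smul]

/-- The Specht module `S^μ`: the submodule of `M^μ` spanned by the `μ`-polytabloids. -/
def spechtModule (n : ℕ) {k : ℕ} (μ : Fin k → ℕ) : Subrepresentation (youngModule n μ) where
  toSubmodule := Submodule.span ℂ (Set.range (Tableau.polytabloid (n := n) (μ := μ)))
  apply_mem_toSubmodule g v hv := by
    induction hv using Submodule.span_induction with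
    | mem x hx =>
      obtain ⟨t, rfl⟩ := hx
      rw [youngModule_polytabloid]
      exact Submodule.subset_span ⟨_, rfl⟩
    | zero => simp
    | add x y _ _ hx hy => rw [map_add]; exact add_mem hx hy
    | smul c x _ hx => rw [map_smul]; exact Submodule.smul_mem _ c hx

/-- The character `χ^μ` of the Specht module `S^μ`. -/
def spechtCharacter (n : ℕ) {k : ℕ} (μ : Fin k → ℕ) : Equiv.Perm (Fin n) → ℂ :=
  (spechtModule n μ).toRepresentation.character

/-! ### Partitions in a box -/

/-- The set of partitions of `r` with at most `b` parts, all of size at most `a`. -/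
def boxPartitions (r a b : ℕ) : Finset (Nat.Partition r) :=
  {p | p.parts.card ≤ b ∧ ∀ i ∈ p.parts, i ≤ a}

end Foulkes

end

namespace Foulkes

open MulAction

/-! Every character involved reduces to permutation characters, and the inner product of two
permutation characters counts orbits on pairs (`charInner_card_fixedBy`). A two-row tabloid is the
same as its second row, an `r`-subset `A`. The orbit of a pair (set partition `P`, subset `A`) is
determined by the multiset of sizes of the intersections of `A` with the blocks of `P`. These are
`b` numbers between `0` and `a` with sum `r`, and dropping the zeros gives a partition of `r` in the
box (`SetPartition.card_orbits`). Conjugating partitions exchanges `a` and `b`.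

For Specht characters with `r > 0`, `M^(n-r,r)` is the direct sum of `S^(n-r,r)` and an injective
image of the permutation module on `(r-1)`-subsets, so the second formula is a difference of two
instances of the first. The image comes from sending an `(r-1)`-set to the sum of the `r`-sets
containing it. It is injective by `eq_zero_of_sum_subset`; it meets the Specht module trivially
because the two are orthogonal; and together they span, because a family of vectors on `r`-sets that
is killed by both must vanish (`eq_zero_of_signed_sums`). -/

/-- Two maps on finite types with equinumerous fibers differ by a bijection of their domains. -/
theorem exists_equiv_of_card_fiber {α β ι : Type*} [Fintype α] [Fintype β] [DecidableEq ι]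
    (f : α → ι) (g : β → ι)
    (h : ∀ i, Fintype.card {x // f x = i} = Fintype.card {y // g y = i}) :
    ∃ e : α ≃ β, ∀ x, g (e x) = f x := by
  refine ⟨(Equiv.sigmaFiberEquiv f).symm.trans
    ((Equiv.sigmaCongrRight fun i => Fintype.equivOfCardEq (h i)).trans
      (Equiv.sigmaFiberEquiv g)), fun x => ?_⟩
  exact (Fintype.equivOfCardEq (h (f x)) ⟨x, rfl⟩).2

/-! ### Permutation characters and direct sums -/

section Characters

variable {G X Y : Type*} [Group G] [MulAction G X] [MulAction G Y]

/-- A permutation character counts fixed points. -/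
theorem character_ofMulAction [Finite X] (g : G) :
    (Representation.ofMulAction ℂ G X).character g = Nat.card (fixedBy X g) := by
  classical
  have := Fintype.ofFinite X
  let b : Module.Basis X ℂ (MonoidAlgebra ℂ X) := .ofRepr (MonoidAlgebra.coeffLinearEquiv ℂ)
  have hb : ∀ x, b x = MonoidAlgebra.single x 1 := fun x => rfl
  rw [Representation.character, LinearMap.trace_eq_matrix_trace ℂ b, Matrix.trace,
    Nat.card_eq_fintype_card, Fintype.card_subtype, Finset.card_filter, Nat.cast_sum]
  refine Finset.sum_congr rfl fun x _ => ?_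
  rw [Matrix.diag_apply, LinearMap.toMatrix_apply, hb, Representation.ofMulAction_single]
  change (MonoidAlgebra.single (g • x) (1 : ℂ)).coeff x = _
  simp [Finsupp.single_apply, mem_fixedBy]

theorem card_fixedBy_congr (e : X ≃ Y) (he : ∀ (g : G) x, e (g • x) = g • e x) (g : G) :
    Nat.card (fixedBy X g) = Nat.card (fixedBy Y g) :=
  Nat.card_congr (e.subtypeEquiv fun x => by
    rw [mem_fixedBy, mem_fixedBy, ← he, e.apply_eq_iff_eq])

/-- The inner product of two permutation characters is the number of orbits on the product. -/
theorem charInner_card_fixedBy [Fintype G] [Finite X] [Finite Y] :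
    charInner (fun g : G => (Nat.card (fixedBy X g) : ℂ)) (fun g => (Nat.card (fixedBy Y g) : ℂ)) =
      Nat.card (orbitRel.Quotient G (X × Y)) := by
  classical
  have := Fintype.ofFinite (X × Y)
  have hfix : ∀ g : G, Fintype.card (fixedBy (X × Y) g) =
      Nat.card (fixedBy X g) * Nat.card (fixedBy Y g) := fun g => by
    rw [← Nat.card_prod, ← Nat.card_eq_fintype_card]
    refine Nat.card_congr (.trans (Equiv.subtypeEquivRight fun p => ?_)
      (Equiv.Set.prod (fixedBy X g) (fixedBy Y g)))
    simp [mem_fixedBy, Prod.ext_iff]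
  have hB := sum_card_fixedBy_eq_card_orbits_mul_card_group G (X × Y)
  have hB' := congrArg (Nat.cast : ℕ → ℂ) hB
  simp only [hfix, Nat.cast_sum, Nat.cast_mul] at hB'
  simp only [charInner, map_natCast, Nat.card_eq_fintype_card (α := orbitRel.Quotient G (X × Y))]
  rw [hB', mul_comm, mul_assoc, mul_inv_cancel₀ (Nat.cast_ne_zero.2 Fintype.card_ne_zero), mul_one]

theorem charInner_sub_right [Fintype G] (φ ψ ψ' : G → ℂ) :
    charInner φ (ψ - ψ') = charInner φ ψ - charInner φ ψ' := by
  simp [charInner, mul_sub, Finset.sum_sub_distrib]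

/-- Characters are additive along a decomposition into a subrepresentation and the image of an
injective intertwining map. -/
theorem character_eq_add_of_isCompl {V W : Type*} [AddCommGroup V] [Module ℂ V] [AddCommGroup W]
    [Module ℂ W] [FiniteDimensional ℂ V] {ρ : Representation ℂ G V} (S : Subrepresentation ρ)
    (σ : Representation ℂ G W) (U : W →ₗ[ℂ] V) (hinj : Function.Injective U)
    (hcomm : ∀ g w, U (σ g w) = ρ g (U w))
    (hcompl : IsCompl S.toSubmodule (LinearMap.range U)) (g : G) :
    ρ.character g = S.toRepresentation.character g + σ.character g := by
  have := FiniteDimensional.of_injective U hinj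
  let e : (S.toSubmodule × W) ≃ₗ[ℂ] V :=
    ((LinearEquiv.refl ℂ _).prodCongr (LinearEquiv.ofInjective U hinj)).trans
      (Submodule.prodEquivOfIsCompl _ _ hcompl)
  have he : ∀ p, e p = p.1 + U p.2 := fun p => by
    simp [e, LinearEquiv.ofInjective_apply]
  have key : ρ g = e.conj ((S.toRepresentation g).prodMap (σ g)) := by
    ext v
    obtain ⟨p, rfl⟩ := e.surjective v
    rw [LinearEquiv.conj_apply_apply, e.symm_apply_apply, he, he, map_add]
    simp only [LinearMap.prodMap_apply, hcomm]
    rfl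
  rw [Representation.character, key, LinearMap.trace_conj', LinearMap.trace_prodMap']
  rfl

end Characters

end Foulkes

namespace Foulkes

/-! ### Conjugation of partitions in a box -/

theorem sum_rowLens (μ : YoungDiagram) : μ.rowLens.sum = μ.card := by
  rw [YoungDiagram.card, Finset.card_eq_sum_card_fiberwise (f := Prod.fst)
    (t := Finset.range (μ.colLen 0)), YoungDiagram.rowLens]
  · simp only [Finset.sum, Finset.range_val, Multiset.range, Multiset.map_coe, Multiset.sum_coe]
    exact congrArg List.sum (List.map_congr_left fun _ _ => μ.rowLen_eq_card)
  · rintro ⟨i, j⟩ h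
    simp only [Finset.coe_range, Set.mem_Iio]
    rw [← YoungDiagram.mem_iff_lt_colLen]
    exact μ.up_left_mem le_rfl (Nat.zero_le j) h

/-- The Young diagram of a partition. -/
noncomputable def diagram {r : ℕ} (p : Nat.Partition r) : YoungDiagram :=
  YoungDiagram.ofRowLens (p.parts.sort (· ≥ ·)) (Multiset.pairwise_sort _ _).sortedGE

theorem rowLens_diagram {r : ℕ} (p : Nat.Partition r) :
    (diagram p).rowLens = p.parts.sort (· ≥ ·) :=
  YoungDiagram.rowLens_ofRowLens_eq_self fun _ hx => p.parts_pos ((Multiset.mem_sort _).1 hx)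

theorem coe_rowLens_diagram {r : ℕ} (p : Nat.Partition r) :
    ((diagram p).rowLens : Multiset ℕ) = p.parts := by
  rw [rowLens_diagram, Multiset.sort_eq]

theorem card_diagram {r : ℕ} (p : Nat.Partition r) : (diagram p).card = r := by
  rw [← sum_rowLens, ← Multiset.sum_coe, coe_rowLens_diagram, p.parts_sum]

theorem diagram_injective {r : ℕ} : Function.Injective (diagram (r := r)) := fun p q h =>
  Nat.Partition.ext (by rw [← coe_rowLens_diagram, h, coe_rowLens_diagram])

/-- The partition given by the row lengths of a Young diagram. -/
def rowPartition {r : ℕ} (μ : YoungDiagram) (h : μ.card = r) : Nat.Partition r where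
  parts := μ.rowLens
  parts_pos {i} hi := μ.pos_of_mem_rowLens i hi
  parts_sum := by rw [Multiset.sum_coe, sum_rowLens, h]

theorem mem_boxPartitions {r a b : ℕ} {p : Nat.Partition r} :
    p ∈ boxPartitions r a b ↔ p.parts.card ≤ b ∧ ∀ i ∈ p.parts, i ≤ a := by
  simp [boxPartitions]

/-- In this form the box condition bounds the first column by `b` and the first row by `a`, so
transposing the diagram visibly swaps the two bounds. -/
theorem rowPartition_mem_boxPartitions {r a b : ℕ} {μ : YoungDiagram} (h : μ.card = r) :
    rowPartition μ h ∈ boxPartitions r a b ↔ μ.colLen 0 ≤ b ∧ μ.rowLen 0 ≤ a := by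
  rw [mem_boxPartitions]
  refine and_congr (by simp [rowPartition]) ⟨fun H => ?_, fun H i hi => ?_⟩
  · by_contra! hlt
    refine hlt.not_ge (H _ ?_)
    have : (0, 0) ∈ μ := YoungDiagram.mem_iff_lt_rowLen.2 (by omega)
    simp only [rowPartition, YoungDiagram.rowLens, Multiset.mem_coe, List.mem_map, List.mem_range]
    exact ⟨0, YoungDiagram.mem_iff_lt_colLen.1 this, rfl⟩
  · simp only [rowPartition, YoungDiagram.rowLens, Multiset.mem_coe, List.mem_map] at hi
    obtain ⟨j, -, rfl⟩ := hi
    exact (μ.rowLen_anti 0 j (Nat.zero_le j)).trans H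

theorem rowPartition_diagram {r : ℕ} (p : Nat.Partition r) :
    rowPartition (diagram p) (card_diagram p) = p :=
  Nat.Partition.ext (coe_rowLens_diagram p)

theorem diagram_rowPartition {r : ℕ} {μ : YoungDiagram} (h : μ.card = r) :
    diagram (rowPartition μ h) = μ := by
  refine YoungDiagram.equivListRowLens.injective (Subtype.ext ?_)
  change (diagram (rowPartition μ h)).rowLens = μ.rowLens
  rw [rowLens_diagram]
  exact List.Perm.eq_of_pairwise' (Multiset.pairwise_sort _ _) μ.rowLens_sorted.pairwise
    (Multiset.coe_eq_coe.1 (Multiset.sort_eq _ _))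

theorem card_transpose (μ : YoungDiagram) : μ.transpose.card = μ.card := by
  simp [YoungDiagram.card, YoungDiagram.transpose]

/-- The conjugate of a partition. -/
noncomputable def conjugate {r : ℕ} (p : Nat.Partition r) : Nat.Partition r :=
  rowPartition (diagram p).transpose ((card_transpose _).trans (card_diagram p))

theorem conjugate_injective {r : ℕ} : Function.Injective (conjugate (r := r)) := fun p q h => by
  have := congrArg diagram h
  simp only [conjugate, diagram_rowPartition] at this
  exact diagram_injective (YoungDiagram.transpose_eq_iff.1 this)

theorem conjugate_mem_boxPartitions {r a b : ℕ} {p : Nat.Partition r}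
    (hp : p ∈ boxPartitions r a b) : conjugate p ∈ boxPartitions r b a := by
  rw [← rowPartition_diagram p, rowPartition_mem_boxPartitions] at hp
  rw [conjugate, rowPartition_mem_boxPartitions, YoungDiagram.colLen_transpose,
    YoungDiagram.rowLen_transpose]
  exact hp.symm

theorem card_boxPartitions_le (r a b : ℕ) :
    (boxPartitions r a b).card ≤ (boxPartitions r b a).card :=
  Finset.card_le_card_of_injOn conjugate (fun _ => conjugate_mem_boxPartitions)
    conjugate_injective.injOn

theorem card_boxPartitions_comm (r a b : ℕ) :
    (boxPartitions r a b).card = (boxPartitions r b a).card :=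
  (card_boxPartitions_le r a b).antisymm (card_boxPartitions_le r b a)

end Foulkes

namespace Foulkes

open MulAction

/-! ### Orbits on pairs of a set partition and a subset -/

/-- The total size fixes the number of zeros. Hence no information is lost when the empty
intersections are dropped, the number of blocks being known. -/
theorem multiset_eq_of_filter_ne_zero {m m' : Multiset ℕ} (hc : m.card = m'.card)
    (h : m.filter (· ≠ 0) = m'.filter (· ≠ 0)) : m = m' := by
  have key : ∀ s : Multiset ℕ, s = Multiset.replicate (s.card - (s.filter (· ≠ 0)).card) 0 +
      s.filter (· ≠ 0) := fun s => by
    have h0 := congrArg Multiset.card (Multiset.filter_add_not (· = 0) s)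
    rw [Multiset.card_add] at h0
    conv_lhs => rw [← Multiset.filter_add_not (· = 0) s]
    congr 1
    rw [Multiset.eq_replicate]
    exact ⟨by simp only [ne_eq]; omega, fun x hx => (Multiset.mem_filter.1 hx).2⟩
  rw [key m, key m', hc, h]

namespace SetPartition

variable {n a b : ℕ}

instance : Finite (SetPartition n a b) := Subtype.finite

/-- The blocks of a set partition. -/
def blocks (P : SetPartition n a b) : Finset (Finset (Fin n)) := Subtype.val P

theorem blocks_injective : Function.Injective (blocks (n := n) (a := a) (b := b)) :=
  Subtype.val_injective

theorem card_blocks (P : SetPartition n a b) : P.blocks.card = b := P.2.1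

theorem card_of_mem_blocks {P : SetPartition n a b} {B : Finset (Fin n)} (hB : B ∈ P.blocks) :
    B.card = a := P.2.2.1 B hB

theorem disjoint_of_mem_blocks {P : SetPartition n a b} {B C : Finset (Fin n)}
    (hB : B ∈ P.blocks) (hC : C ∈ P.blocks) (hne : B ≠ C) : Disjoint B C :=
  P.2.2.2.1 B hB C hC hne

theorem exists_mem_blocks (P : SetPartition n a b) (x : Fin n) : ∃ B ∈ P.blocks, x ∈ B :=
  P.2.2.2.2 x

theorem blocks_smul (σ : Equiv.Perm (Fin n)) (P : SetPartition n a b) :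
    (σ • P).blocks = P.blocks.image (σ • ·) := rfl

theorem existsUnique_block (P : SetPartition n a b) (x : Fin n) :
    ∃ B : P.blocks, x ∈ B.1 ∧ ∀ C : P.blocks, x ∈ C.1 → C = B := by
  obtain ⟨B, hB, hx⟩ := P.exists_mem_blocks x
  refine ⟨⟨B, hB⟩, hx, fun C hC => Subtype.ext ?_⟩
  by_contra hne
  exact Finset.disjoint_left.1 (disjoint_of_mem_blocks C.2 hB hne) hC hx

/-- The block containing a given element. -/
noncomputable def block (P : SetPartition n a b) (x : Fin n) : P.blocks :=
  (P.existsUnique_block x).choose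

theorem block_eq_iff {P : SetPartition n a b} {x : Fin n} {B : P.blocks} :
    P.block x = B ↔ x ∈ B.1 := by
  have h := (P.existsUnique_block x).choose_spec
  exact ⟨fun hB => hB ▸ h.1, fun hx => (h.2 B hx).symm⟩

/-- The sizes of the intersections of `A` with the blocks of `P`. -/
def meets (P : SetPartition n a b) (A : Finset (Fin n)) : Multiset ℕ :=
  P.blocks.val.map fun B => (A ∩ B).card

theorem card_meets (P : SetPartition n a b) (A : Finset (Fin n)) : (P.meets A).card = b := by
  rw [meets, Multiset.card_map]; exact P.card_blocks

theorem le_of_mem_meets {P : SetPartition n a b} {A : Finset (Fin n)} {i : ℕ}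
    (hi : i ∈ P.meets A) : i ≤ a := by
  obtain ⟨B, hB, rfl⟩ := Multiset.mem_map.1 hi
  exact (Finset.card_le_card Finset.inter_subset_right).trans_eq (card_of_mem_blocks hB)

theorem sum_meets (P : SetPartition n a b) (A : Finset (Fin n)) : (P.meets A).sum = A.card := by
  change ∑ B ∈ P.blocks, (A ∩ B).card = A.card
  rw [← Finset.card_biUnion]
  · congr 1
    ext x
    simp only [Finset.mem_biUnion, Finset.mem_inter]
    exact ⟨fun ⟨_, _, h, _⟩ => h, fun h => (P.exists_mem_blocks x).imp fun B hB => ⟨hB.1, h, hB.2⟩⟩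
  · intro B hB C hC hne
    exact (disjoint_of_mem_blocks hB hC hne).mono Finset.inter_subset_right Finset.inter_subset_right

theorem meets_smul (σ : Equiv.Perm (Fin n)) (P : SetPartition n a b) (A : Finset (Fin n)) :
    (σ • P).meets (σ • A) = P.meets A := by
  rw [meets, blocks_smul,
    Finset.image_val_of_injOn (MulAction.injective σ).injOn, Multiset.map_map]
  refine Multiset.map_congr rfl fun B _ => ?_
  rw [Function.comp_apply, ← Finset.smul_finset_inter, Finset.card_smul_finset]

theorem card_fiber_inter (P : SetPartition n a b) (A : Finset (Fin n)) (i : ℕ) :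
    Fintype.card {B : P.blocks // (A ∩ B.1).card = i} = (P.meets A).count i := by
  rw [meets, Multiset.count_map, Fintype.card_subtype]
  rw [← Finset.card_map (Function.Embedding.subtype _)]
  change _ = (P.blocks.filter fun B => i = (A ∩ B).card).card
  congr 1
  ext B
  simp [eq_comm, and_comm]

theorem card_fiber_block (P : SetPartition n a b) (A : Finset (Fin n)) (B : P.blocks) (c : Bool) :
    Fintype.card {x // (P.block x, decide (x ∈ A)) = (B, c)} =
      bif c then (A ∩ B.1).card else a - (A ∩ B.1).card := by
  rw [Fintype.card_subtype]
  cases c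
  · rw [cond_false]
    refine Eq.trans ?_ ((Finset.card_sdiff (s := A) (t := B.1)).trans (by rw [card_of_mem_blocks B.2]))
    congr 1
    ext x
    simp [block_eq_iff]
  · rw [cond_true]
    congr 1
    ext x
    simp [block_eq_iff, and_comm]

/-- The permutation is built in two stages: first a bijection `e` of blocks preserving the
intersection sizes, then a bijection of points compatible with `e` and with membership in the
subsets. The second exists because all blocks have size `a`, so the parts outside the subsets match
as well. -/
theorem exists_smul_eq {P P' : SetPartition n a b} {A A' : Finset (Fin n)}
    (h : P.meets A = P'.meets A') : ∃ σ : Equiv.Perm (Fin n), σ • P = P' ∧ σ • A = A' := by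
  obtain ⟨e, he⟩ := exists_equiv_of_card_fiber (fun B : P.blocks => (A ∩ B.1).card)
    (fun B : P'.blocks => (A' ∩ B.1).card) fun i => by rw [card_fiber_inter, card_fiber_inter, h]
  obtain ⟨σ, hσ⟩ := exists_equiv_of_card_fiber (fun x => (e (P.block x), decide (x ∈ A)))
    (fun x => (P'.block x, decide (x ∈ A'))) fun ⟨B, c⟩ => by
      obtain ⟨B, rfl⟩ := e.surjective B
      rw [card_fiber_block, he, ← card_fiber_block P A B c]
      exact Fintype.card_congr (Equiv.subtypeEquivRight fun x => by simp)
  simp only [Prod.mk.injEq, decide_eq_decide] at hσ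
  have hB : ∀ B : P.blocks, σ • B.1 = (e B).1 := fun B => by
    refine Finset.eq_of_subset_of_card_le (fun y hy => ?_) ?_
    · obtain ⟨x, hx, rfl⟩ := Finset.mem_smul_finset.1 hy
      rw [← block_eq_iff, Equiv.Perm.smul_def, (hσ x).1, block_eq_iff.2 hx]
    · rw [Finset.card_smul_finset, card_of_mem_blocks B.2, card_of_mem_blocks (e B).2]
  refine ⟨σ, blocks_injective (Finset.eq_of_subset_of_card_le (fun C hC => ?_) ?_), ?_⟩
  · obtain ⟨B, hBP, rfl⟩ := Finset.mem_image.1 hC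
    rw [hB ⟨B, hBP⟩]
    exact (e _).2
  · rw [card_blocks, card_blocks]
  · ext y
    obtain ⟨x, rfl⟩ := σ.surjective y
    rw [(hσ x).2, ← Equiv.Perm.smul_def, Finset.smul_mem_smul_finset_iff]

/-- Arrange the points in an array with `b` rows of length `a`: the blocks are the rows, and `A`
takes the first `c j` entries of row `j`. Positivity of `a` keeps the rows distinct as sets. -/
theorem exists_meets_eq (ha : 0 < a) (hn : n = a * b) (c : Fin b → ℕ) (hc : ∀ j, c j ≤ a) :
    ∃ (P : SetPartition n a b) (A : Finset (Fin n)), P.meets A = Finset.univ.val.map c := by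
  let e : Fin b × Fin a ≃ Fin n := finProdFinEquiv.trans (finCongr (by rw [hn, mul_comm]))
  let blk : Fin b → Finset (Fin n) := fun j => {x | (e.symm x).1 = j}
  have hblk : Function.Injective blk := fun j j' h => by
    have : e (j, ⟨0, ha⟩) ∈ blk j' := h ▸ by simp [blk]
    simpa [blk] using this
  have hcard : ∀ (j : Fin b) (m : ℕ), m ≤ a →
      (Finset.univ.filter fun x => (e.symm x).1 = j ∧ ((e.symm x).2 : ℕ) < m).card = m := by
    intro j m hm
    have : (Finset.univ.filter fun i : Fin a => (i : ℕ) < m).card = m := by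
      simpa [hm] using Fin.card_filter_val_lt (n := a) (m := m)
    refine Eq.trans ?_ this
    refine Finset.card_bij' (fun x _ => (e.symm x).2) (fun i _ => e (j, i)) ?_ ?_ ?_ ?_
    · simp
    · simp
    · intro x hx
      simp only [Finset.mem_filter, Finset.mem_univ, true_and] at hx
      rw [← hx.1]; simp
    · simp
  refine ⟨⟨Finset.univ.image blk, ?_, ?_, ?_, ?_⟩,
    Finset.univ.filter fun x => ((e.symm x).2 : ℕ) < c (e.symm x).1, ?_⟩
  · rw [Finset.card_image_of_injective _ hblk, Finset.card_univ, Fintype.card_fin]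
  · simp only [Finset.mem_image, Finset.mem_univ, true_and, forall_exists_index,
      forall_apply_eq_imp_iff]
    intro j
    rw [← hcard j a le_rfl]
    congr 1
    ext x
    simp [blk]
  · simp only [Finset.mem_image, Finset.mem_univ, true_and, forall_exists_index,
      forall_apply_eq_imp_iff]
    intro j j' hne
    refine Finset.disjoint_left.2 fun x hx hx' => hne ?_
    simp only [blk, Finset.mem_filter, Finset.mem_univ, true_and] at hx hx'
    rw [← hx, ← hx']
  · exact fun x => ⟨blk (e.symm x).1, by simp, by simp [blk]⟩
  · change Multiset.map _ (Finset.univ.image blk).val = _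
    rw [Finset.image_val_of_injOn hblk.injOn, Multiset.map_map]
    refine Multiset.map_congr rfl fun j _ => ?_
    conv_rhs => rw [← hcard j (c j) (hc j)]
    rw [Function.comp_apply]
    congr 1
    ext x
    simp only [blk, Finset.mem_inter, Finset.mem_filter, Finset.mem_univ, true_and]
    constructor
    · rintro ⟨h1, rfl⟩; exact ⟨rfl, h1⟩
    · rintro ⟨rfl, h1⟩; exact ⟨h1, rfl⟩

/-- The partition recording the nonzero intersections of `A` with the blocks of `P`. -/
def meetPartition {r : ℕ} (q : SetPartition n a b × Set.powersetCard (Fin n) r) :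
    Nat.Partition r :=
  .ofSums r (q.1.meets q.2) (by rw [sum_meets, q.2.2])

theorem meetPartition_mem {r : ℕ} (q : SetPartition n a b × Set.powersetCard (Fin n) r) :
    meetPartition q ∈ boxPartitions r a b := by
  rw [mem_boxPartitions]
  exact ⟨(Multiset.card_le_card (Multiset.filter_le _ _)).trans_eq (card_meets _ _),
    fun i hi => le_of_mem_meets (Multiset.mem_of_mem_filter hi)⟩

theorem meetPartition_eq_iff {r : ℕ} {q q' : SetPartition n a b × Set.powersetCard (Fin n) r} :
    meetPartition q = meetPartition q' ↔ orbitRel (Equiv.Perm (Fin n)) _ q q' := by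
  rw [orbitRel_apply, mem_orbit_iff]
  constructor
  · intro h
    have hm : q'.1.meets q'.2 = q.1.meets q.2 := multiset_eq_of_filter_ne_zero
      (by rw [card_meets, card_meets]) (congrArg Nat.Partition.parts h).symm
    obtain ⟨σ, h1, h2⟩ := exists_smul_eq hm
    exact ⟨σ, Prod.ext h1 (Subtype.ext h2)⟩
  · rintro ⟨σ, rfl⟩
    refine Nat.Partition.ext ?_
    exact congrArg (Multiset.filter (· ≠ 0)) (meets_smul σ q'.1 q'.2.1)

theorem exists_meetPartition_eq {r : ℕ} (ha : 0 < a) (hn : n = a * b) {p : Nat.Partition r}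
    (hp : p ∈ boxPartitions r a b) :
    ∃ q : SetPartition n a b × Set.powersetCard (Fin n) r, meetPartition q = p := by
  rw [mem_boxPartitions] at hp
  -- Padding with zeros to exactly `b` entries accounts for the blocks that miss the subset.
  obtain ⟨l, hl⟩ : ∃ l : List ℕ,
      (l : Multiset ℕ) = p.parts + Multiset.replicate (b - p.parts.card) 0 :=
    ⟨_, Multiset.coe_toList _⟩
  have hlen : l.length = b := by
    rw [← Multiset.coe_card, hl, Multiset.card_add, Multiset.card_replicate]; omega
  subst hlen
  obtain ⟨P, A, hPA⟩ := exists_meets_eq ha hn l.get fun j => by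
    have : l.get j ∈ (l : Multiset ℕ) := l.get_mem j
    rw [hl, Multiset.mem_add] at this
    rcases this with h | h
    · exact hp.2 _ h
    · rw [Multiset.eq_of_mem_replicate h]; exact Nat.zero_le a
  have hm : P.meets A = p.parts + Multiset.replicate (l.length - p.parts.card) 0 := by
    rw [hPA, Fin.univ_val_map, List.ofFn_get, hl]
  refine ⟨(P, ⟨A, ?_⟩), Nat.Partition.ext ?_⟩
  · change A.card = r
    rw [← sum_meets P, hm, Multiset.sum_add, p.parts_sum]; simp
  · change (P.meets A).filter (· ≠ 0) = p.parts
    rw [hm, Multiset.filter_add, Multiset.filter_eq_self.2 fun i hi => (p.parts_pos hi).ne',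
      Multiset.filter_eq_nil.2 fun i hi => by simp [Multiset.eq_of_mem_replicate hi], add_zero]

/-- Orbits on pairs of a set partition and an `r`-subset correspond to partitions in a box. -/
theorem card_orbits {r : ℕ} (ha : 0 < a) (hn : n = a * b) :
    Nat.card (orbitRel.Quotient (Equiv.Perm (Fin n))
      (SetPartition n a b × Set.powersetCard (Fin n) r)) = (boxPartitions r a b).card := by
  rw [← Nat.card_eq_finsetCard]
  let f : orbitRel.Quotient (Equiv.Perm (Fin n))
      (SetPartition n a b × Set.powersetCard (Fin n) r) → boxPartitions r a b :=
    Quotient.lift (fun q => ⟨meetPartition q, meetPartition_mem q⟩)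
      fun q q' h => Subtype.ext (meetPartition_eq_iff.2 h)
  refine Nat.card_eq_of_bijective f ⟨?_, ?_⟩
  · rintro ⟨q⟩ ⟨q'⟩ h
    exact Quotient.sound (meetPartition_eq_iff.1 (congrArg Subtype.val h))
  · rintro ⟨p, hp⟩
    obtain ⟨q, hq⟩ := exists_meetPartition_eq ha hn hp
    exact ⟨Quotient.mk _ q, Subtype.ext hq⟩

end SetPartition

end Foulkes

namespace Foulkes

/-! ### Families indexed by the `r`-subsets of a finite set -/

section Subsets

variable {α Q : Type*} [Fintype α] [DecidableEq α] [AddCommGroup Q]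
  {r : ℕ} {φ : Finset α → Q}

theorem sum_insert_disjoint (J D : Finset α) (x : α) :
    ∑ B with J ⊆ B ∧ Disjoint (insert x D) B, φ B =
      ∑ B with J ⊆ B ∧ Disjoint D B, φ B - ∑ B with insert x J ⊆ B ∧ Disjoint D B, φ B := by
  simp only [Finset.sum_filter]
  rw [← Finset.sum_sub_distrib]
  refine Finset.sum_congr rfl fun B _ => ?_
  by_cases hx : x ∈ B <;> simp [Finset.insert_subset_iff, hx]

variable [Module ℂ Q]

/-- Vanishing at level `r - 1` propagates downwards: summing over all one-point enlargements of `C`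
counts each `r`-set containing `C` a fixed nonzero number of times. -/
theorem sum_superset_eq_zero (hφ : ∀ B, B.card ≠ r → φ B = 0)
    (h : ∀ C : Finset α, C.card + 1 = r → ∑ B with C ⊆ B, φ B = 0) (C : Finset α)
    (hC : C.card < r) : ∑ B with C ⊆ B, φ B = 0 := by
  obtain ⟨k, hk⟩ : ∃ k, C.card + 1 + k = r := ⟨r - (C.card + 1), by omega⟩
  clear hC
  induction k generalizing C with
  | zero => exact h C hk
  | succ k ih =>
    have h1 : ∑ x ∈ Cᶜ, ∑ B with insert x C ⊆ B, φ B = 0 := Finset.sum_eq_zero fun x hx =>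
      ih _ (by rw [Finset.card_insert_of_notMem (Finset.mem_compl.1 hx)]; omega)
    -- Here `C` has `r - (k + 2)` elements, so an `r`-set `B` containing `C` arises once for each of
    -- the `k + 2` points of `B \ C`.
    have h2 : ∑ x ∈ Cᶜ, ∑ B with insert x C ⊆ B, φ B = (k + 2 : ℂ) • ∑ B with C ⊆ B, φ B := by
      simp only [Finset.sum_filter]
      rw [Finset.sum_comm, Finset.smul_sum]
      refine Finset.sum_congr rfl fun B _ => ?_
      by_cases hCB : C ⊆ B
      · by_cases hB : B.card = r
        · rw [if_pos hCB, ← Finset.sum_filter, Finset.sum_const]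
          have : (Finset.filter (fun x => insert x C ⊆ B) Cᶜ) = B \ C := by
            ext x; simp [Finset.insert_subset_iff, hCB, and_comm]
          rw [this, Finset.card_sdiff_of_subset hCB, show B.card - C.card = k + 2 by omega,
            ← Nat.cast_smul_eq_nsmul ℂ]
          push_cast; rfl
        · simp [hφ B hB]
      · simp [Finset.insert_subset_iff, hCB]
    rw [h2] at h1
    exact (smul_eq_zero.1 h1).resolve_left (by exact_mod_cast (by omega : k + 2 ≠ 0))

/-- Inclusion-exclusion, adding one point at a time to `D`. Below total size `r` both terms of
`sum_insert_disjoint` vanish; at size `r` only the term with the new point moved into `J` survives,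
with a change of sign. -/
theorem sum_superset_disjoint (hφ : ∀ B, B.card ≠ r → φ B = 0)
    (h : ∀ C : Finset α, C.card < r → ∑ B with C ⊆ B, φ B = 0) (D : Finset α) :
    (∀ J : Finset α, J.card + D.card < r → ∑ B with J ⊆ B ∧ Disjoint D B, φ B = 0) ∧
      ∀ J : Finset α, Disjoint J D → J.card + D.card = r →
        ∑ B with J ⊆ B ∧ Disjoint D B, φ B = (-1 : ℂ) ^ D.card • φ (J ∪ D) := by
  induction D using Finset.induction_on with
  | empty =>
    simp only [Finset.card_empty, add_zero, Finset.disjoint_empty_left, and_true, pow_zero,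
      one_smul, Finset.union_empty, Finset.disjoint_empty_right, true_implies]
    refine ⟨fun J => h J, fun J hJ => ?_⟩
    rw [Finset.sum_eq_single_of_mem J (by simp)]
    intro B hB hne
    refine hφ B fun hB' => hne (Finset.eq_of_subset_of_card_le (Finset.mem_filter.1 hB).2 ?_).symm
    omega
  | insert x D hx ih =>
    rw [Finset.card_insert_of_notMem hx]
    refine ⟨fun J hJ => ?_, fun J hd hJ => ?_⟩
    · have := Finset.card_insert_le x J
      rw [sum_insert_disjoint, ih.1 J (by omega), ih.1 (insert x J) (by omega), sub_zero]
    · rw [Finset.disjoint_insert_right] at hd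
      rw [sum_insert_disjoint, ih.1 J (by omega), ih.2 (insert x J)
        (Finset.disjoint_insert_left.2 ⟨hx, hd.2⟩)
        (by rw [Finset.card_insert_of_notMem hd.1]; omega), zero_sub, pow_succ, mul_neg_one,
        neg_smul, Finset.insert_union, Finset.union_insert]

theorem exists_perm_fixing {A B B' : Finset α} (hcard : B.card = B'.card)
    (hA : A ∩ B = A ∩ B') : ∃ σ : Equiv.Perm α, (∀ x ∈ A, σ x = x) ∧ σ • B' = B := by
  -- Each point of `A` gets a colour of its own in the first coordinate, so a colour-preserving
  -- bijection must fix it. Outside `A` only membership in the given set is recorded.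
  let col : Finset α → α → Option α × Bool := fun B x =>
    (if x ∈ A then some x else none, decide (x ∈ B))
  have hmem : ∀ x ∈ A, (x ∈ B ↔ x ∈ B') := fun x hx => by
    simpa [hx] using Finset.ext_iff.1 hA x
  have hsd : (B \ A).card = (B' \ A).card := by
    rw [Finset.card_sdiff, Finset.card_sdiff, hA, hcard]
  obtain ⟨σ, hσ⟩ := exists_equiv_of_card_fiber (col B') (col B) (by
    rintro ⟨_ | y, c⟩
    · have hun : (Aᶜ \ B').card = (Aᶜ \ B).card := by
        have e1 := Finset.card_sdiff_add_card_inter Aᶜ B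
        have e2 := Finset.card_sdiff_add_card_inter Aᶜ B'
        rw [Finset.inter_comm, ← Finset.sdiff_eq_inter_compl] at e1 e2
        omega
      rw [Fintype.card_subtype, Fintype.card_subtype]
      cases c
      · convert hun using 2 <;> ext x <;> simp [col]
      · convert hsd.symm using 2 <;> ext x <;> simp [col, and_comm]
    · refine Fintype.card_congr (Equiv.subtypeEquivRight fun x => ?_)
      by_cases hx : x ∈ A
      · simp [col, hx, hmem x hx]
      · simp [col, hx])
  simp only [col, Prod.mk.injEq, decide_eq_decide] at hσ
  refine ⟨σ, fun x hx => ?_, ?_⟩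
  · have := (hσ x).1
    rw [if_pos hx] at this
    split_ifs at this
    simpa using this
  · ext y
    obtain ⟨x, rfl⟩ := σ.surjective y
    rw [(hσ x).2, ← Equiv.Perm.smul_def, Finset.smul_mem_smul_finset_iff]

/-- The orbit of `B'` under the pointwise stabilizer of `A` consists of the `r`-sets `B` with `A ∩ B
= A ∩ B'`, each hit equally often. Those are the sets containing `A ∩ B'` and avoiding `A \ B'`, so
`sum_superset_disjoint` evaluates the sum. The multiplicity `m` is the order of the stabilizer of
`B'` within that group. -/
theorem sum_fixing_smul (hφ : ∀ B, B.card ≠ r → φ B = 0)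
    (h : ∀ C : Finset α, C.card < r → ∑ B with C ⊆ B, φ B = 0) {A B' : Finset α}
    (hA : A.card = r) (hB' : B'.card = r) :
    ∃ m : ℕ, 0 < m ∧ ∑ g : Equiv.Perm α with ∀ x ∈ A, g x = x, φ (g • B') =
      (m : ℂ) • (-1 : ℂ) ^ (A \ B').card • φ A := by
  refine ⟨(Finset.univ.filter fun g : Equiv.Perm α => (∀ x ∈ A, g x = x) ∧ g • B' = B').card,
    Finset.card_pos.2 ⟨1, by simp⟩, ?_⟩
  have hdisj : Disjoint (A ∩ B') (A \ B') := (Finset.disjoint_sdiff_inter A B').symm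
  have key := (sum_superset_disjoint hφ h (A \ B')).2 (A ∩ B') hdisj
    (by rw [add_comm, Finset.card_sdiff_add_card_inter, hA])
  rw [Finset.union_comm, Finset.sdiff_union_inter] at key
  rw [← key, Finset.smul_sum, ← Finset.sum_fiberwise _ (fun g => g • B'), Finset.sum_filter]
  refine Finset.sum_congr rfl fun B _ => ?_
  rw [Finset.sum_congr rfl (g := fun _ => φ B) fun g hg => by rw [(Finset.mem_filter.1 hg).2],
    Finset.sum_const, Finset.filter_filter, ← Nat.cast_smul_eq_nsmul ℂ]
  by_cases hB : B.card = r
  · have hiff : A ∩ B' ⊆ B ∧ Disjoint (A \ B') B ↔ A ∩ B = A ∩ B' := by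
      simp only [Finset.ext_iff, Finset.subset_iff, Finset.disjoint_left, Finset.mem_inter,
        Finset.mem_sdiff]
      grind
    split_ifs with hc
    · obtain ⟨k, hk, hkB⟩ := exists_perm_fixing (hB.trans hB'.symm) (hiff.1 hc)
      congr 2
      refine Finset.card_bij' (fun g _ => k⁻¹ * g) (fun g _ => k * g) ?_ ?_ ?_ ?_
      · intro g hg
        simp only [Finset.mem_filter, Finset.mem_univ, true_and] at hg ⊢
        refine ⟨fun x hx => ?_, by rw [mul_smul, hg.2, ← hkB, inv_smul_smul]⟩
        rw [Equiv.Perm.mul_apply, hg.1 x hx, Equiv.Perm.inv_eq_iff_eq, hk x hx]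
      · intro g hg
        simp only [Finset.mem_filter, Finset.mem_univ, true_and] at hg ⊢
        refine ⟨fun x hx => ?_, by rw [mul_smul, hg.2, hkB]⟩
        rw [Equiv.Perm.mul_apply, hg.1 x hx, hk x hx]
      · simp
      · simp
    · rw [Finset.card_eq_zero.2, Nat.cast_zero, zero_smul]
      refine Finset.filter_eq_empty_iff.2 fun g _ hg => hc (hiff.2 ?_)
      have hgA : g • A = A := by
        refine Finset.eq_of_subset_of_card_le (fun y hy => ?_) (Finset.card_smul_finset _ _).ge
        obtain ⟨x, hx, rfl⟩ := Finset.mem_smul_finset.1 hy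
        rwa [Equiv.Perm.smul_def, hg.1 x hx]
      have hgfix : g • (A ∩ B') = A ∩ B' := by
        refine Finset.eq_of_subset_of_card_le (fun y hy => ?_) (Finset.card_smul_finset _ _).ge
        obtain ⟨x, hx, rfl⟩ := Finset.mem_smul_finset.1 hy
        rwa [Equiv.Perm.smul_def, hg.1 x (Finset.mem_inter.1 hx).1]
      rw [← hg.2, ← hgfix, Finset.smul_finset_inter, hgA]
  · simp [hφ B hB]

/-- If the sums of `φ` over the supersets of small sets vanish, and so do the signed sums of `φ`
along the translates by a set `Γ` of permutations, then `φ` vanishes at `A`. -/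
theorem eq_zero_of_signed_sums (hφ : ∀ B, B.card ≠ r → φ B = 0)
    (h : ∀ C : Finset α, C.card < r → ∑ B with C ⊆ B, φ B = 0) {A : Finset α}
    (hA : A.card = r) (Γ : Finset (Equiv.Perm α)) (hone : 1 ∈ Γ)
    (hsign : ∀ π ∈ Γ, Equiv.Perm.sign π = (-1) ^ (A \ π • A).card)
    (hsum : ∀ g : Equiv.Perm α,
      ∑ π ∈ Γ, ((Equiv.Perm.sign π : ℤ) : ℂ) • φ (g • π • A) = 0) : φ A = 0 := by
  choose m hm hm' using fun π : Equiv.Perm α =>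
    sum_fixing_smul hφ h hA ((Finset.card_smul_finset π A).trans hA)
  have h0 : ∑ g : Equiv.Perm α with ∀ x ∈ A, g x = x,
      ∑ π ∈ Γ, ((Equiv.Perm.sign π : ℤ) : ℂ) • φ (g • π • A) = 0 :=
    Finset.sum_eq_zero fun g _ => hsum g
  rw [Finset.sum_comm] at h0
  -- The sign of `π` cancels the sign from `sum_fixing_smul`, so every `π` contributes a positive
  -- multiple of `φ A` and no cancellation can occur.
  have h1 : ∀ π ∈ Γ, ∑ g : Equiv.Perm α with ∀ x ∈ A, g x = x,
      ((Equiv.Perm.sign π : ℤ) : ℂ) • φ (g • π • A) = (m π : ℂ) • φ A := fun π hπ => by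
    rw [← Finset.smul_sum, hm' π, hsign π hπ, smul_comm, smul_smul ((_ : ℤ) : ℂ)]
    push_cast
    rw [← mul_pow, neg_one_mul, neg_neg, one_pow, one_smul]
  rw [Finset.sum_congr rfl h1, ← Finset.sum_smul, ← Nat.cast_sum] at h0
  refine (smul_eq_zero.1 h0).resolve_left (Nat.cast_ne_zero.2 ?_)
  exact (Finset.sum_pos (fun π _ => hm π) ⟨1, hone⟩).ne'

/-- A family on the `s`-subsets of a set with more than `2 * s` elements vanishes if its sums over
the subsets of each `(s + 1)`-subset do. -/
theorem eq_zero_of_sum_subset {s : ℕ} (hs : 2 * s < Fintype.card α)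
    (hφ : ∀ B, B.card ≠ s → φ B = 0)
    (h : ∀ B : Finset α, B.card = s + 1 → ∑ C with C ⊆ B, φ C = 0) : φ = 0 := by
  have hcc : ∀ B : Finset α, B.card + Bᶜ.card = Fintype.card α := Finset.card_add_card_compl
  -- Complementation turns sums over subsets into sums over supersets, now for a family on sets of
  -- size `Fintype.card α - s`.
  have hψ : ∀ B : Finset α, B.card ≠ Fintype.card α - s → φ Bᶜ = 0 := fun B hB =>
    hφ _ (by have := hcc B; omega)
  have h' : ∀ C : Finset α, C.card < Fintype.card α - s → ∑ B with C ⊆ B, φ Bᶜ = 0 := by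
    refine sum_superset_eq_zero hψ fun C hC => ?_
    rw [← h Cᶜ (by have := hcc C; omega)]
    refine Finset.sum_bij' (fun B _ => Bᶜ) (fun B _ => Bᶜ) ?_ ?_ ?_ ?_ ?_ <;> simp
    intro B hB; rwa [Finset.subset_compl_comm]
  funext B
  by_cases hB : B.card = s
  · have hB' := hcc B
    -- With `J` empty and `D = Bᶜ`, the sum runs over subsets of `B`. These have at most `s <
    -- Fintype.card α - s` elements, so every term is zero, while the other side is `φ B` up to
    -- sign.
    have key := (sum_superset_disjoint hψ h' Bᶜ).2 ∅ (Finset.disjoint_empty_left _)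
      (by rw [Finset.card_empty]; omega)
    rw [Finset.sum_eq_zero, Finset.empty_union, compl_compl] at key
    · exact (smul_eq_zero.1 key.symm).resolve_left (pow_ne_zero _ (by norm_num))
    · intro C hC
      refine hψ C fun hC' => ?_
      have hsub : C ⊆ B := by
        have := (Finset.mem_filter.1 hC).2.2
        rwa [disjoint_comm, ← Finset.subset_compl_iff_disjoint_right, compl_compl] at this
      have := Finset.card_le_card hsub
      omega
  · exact hφ B hB

/-- The sign of a permutation that preserves columns of length at most two. -/
theorem sign_eq_of_preserves_columns {ι : Type*} {col : α → ι} {A : Finset α}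
    (h1 : Set.InjOn col A) (h2 : Set.InjOn col (Aᶜ : Finset α)) {π : Equiv.Perm α}
    (hπ : ∀ x, col (π x) = col x) : Equiv.Perm.sign π = (-1) ^ (A \ π • A).card := by
  have hin : ∀ x y, col x = col y → (x ∈ A ↔ y ∈ A) → x = y := fun x y hxy hA => by
    by_cases hx : x ∈ A
    · exact h1 hx (hA.1 hx) hxy
    · exact h2 (by simpa using hx) (by simpa using mt hA.2 hx) hxy
  -- A column has at most one entry in `A` and one outside, so `π` can only swap these two. Thus `π`
  -- is a product of disjoint transpositions, each with exactly one point in `A`, and `A \ π • A`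
  -- counts them.
  have hsw : ∀ x, π x ≠ x → (π x ∈ A ↔ x ∉ A) := fun x hx => by
    by_contra hcon
    exact hx (hin _ _ (hπ x) (by tauto))
  have hinv : ∀ x, π (π x) = x := fun x => by
    by_cases hx : π x = x
    · rw [hx, hx]
    · have hx' : π (π x) ≠ π x := fun hh => hx (π.injective hh)
      exact hin _ _ ((hπ _).trans (hπ x)) (by have := hsw _ hx; have := hsw _ hx'; tauto)
  have hsq : π ^ 2 = 1 := by ext x; simp [sq, hinv]
  have hA' : A \ π • A = π.support ∩ A := by
    ext x
    have : x ∈ π • A ↔ π x ∈ A := by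
      rw [← Finset.inv_smul_mem_iff, show π⁻¹ = π from inv_eq_of_mul_eq_one_left
        (by rw [← sq, hsq])]
      rfl
    rw [Finset.mem_sdiff, this, Finset.mem_inter, Equiv.Perm.mem_support]
    have := hsw x
    constructor
    · rintro ⟨hx, hx'⟩; exact ⟨fun hh => hx' (by rwa [hh]), hx⟩
    · tauto
  have hhalf : (π.support ∩ A).card = (π.support \ A).card := by
    refine Finset.card_bij' (fun x _ => π x) (fun x _ => π x) ?_ ?_ (fun x _ => hinv x)
      (fun x _ => hinv x) <;> intro x hx <;>
      simp only [Finset.mem_inter, Finset.mem_sdiff, Equiv.Perm.mem_support] at hx ⊢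
    · exact ⟨fun hh => hx.1 (π.injective hh), fun hh => (hsw x hx.1).1 hh hx.2⟩
    · exact ⟨fun hh => hx.1 (π.injective hh), (hsw x hx.1).2 hx.2⟩
  have hsupp : Fintype.card α - Fintype.card (Function.fixedPoints π) = π.support.card := by
    rw [Equiv.Perm.card_fixedPoints, Equiv.Perm.sum_cycleType]
    have := π.support.card_le_univ
    omega
  have htot := Finset.card_sdiff_add_card_inter π.support A
  rw [Equiv.Perm.sign_of_pow_two_eq_one hsq, hsupp, hA']
  congr 1
  omega

end Subsets

end Foulkes

namespace Foulkes

open MulAction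

/-! ### Tabloids with two rows -/

theorem sum_extend {X Y Q : Type*} [Fintype X] [Fintype Y] [AddCommMonoid Q] {i : X → Y}
    (hi : Function.Injective i) (f : X → Q) (p : Y → Prop) [DecidablePred p] :
    ∑ y with p y, Function.extend i f 0 y = ∑ x with p (i x), f x := by
  simp only [Finset.sum_filter]
  refine (Finset.sum_of_injOn i hi.injOn (by simp) (fun y _ hy => ?_) fun x _ => ?_).symm
  · rw [Function.extend_apply' _ _ _ (by simpa using hy)]; simp
  · rw [hi.extend_apply]

namespace Tabloid

variable {n : ℕ} {μ : Fin 2 → ℕ}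

/-- The entries in the second row of a tabloid with two rows. -/
def bottom (T : Tabloid n μ) : Finset (Fin n) :=
  Quotient.lift (fun t : Tableau n μ => Finset.univ.filter fun x => t.row x = 1)
    (fun _ _ h => Finset.filter_congr fun x _ => by rw [h x]) T

theorem mem_bottom {t : Tableau n μ} {x : Fin n} : x ∈ t.toTabloid.bottom ↔ t.row x = 1 := by
  simp [Tableau.toTabloid, bottom]

theorem exists_toTabloid_eq (T : Tabloid n μ) : ∃ t : Tableau n μ, t.toTabloid = T :=
  Quotient.exists_rep T

theorem bottom_injective : Function.Injective (bottom (n := n) (μ := μ)) := fun T T' h => by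
  obtain ⟨t, rfl⟩ := T.exists_toTabloid_eq
  obtain ⟨t', rfl⟩ := T'.exists_toTabloid_eq
  refine Quotient.sound fun x => ?_
  have := Finset.ext_iff.1 h x
  rw [mem_bottom, mem_bottom] at this
  omega

theorem bottom_smul (σ : Equiv.Perm (Fin n)) (T : Tabloid n μ) :
    (σ • T).bottom = σ • T.bottom := by
  obtain ⟨t, rfl⟩ := T.exists_toTabloid_eq
  ext x
  rw [smul_toTabloid, mem_bottom, ← Finset.inv_smul_mem_iff, mem_bottom, Tableau.row_smul]
  rfl

theorem card_fiber_fst (i : Fin 2) :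
    Fintype.card {c : Σ i : Fin 2, Fin (μ i) // c.1 = i} = μ i := by
  rw [← Fintype.card_fin (μ i)]
  refine (Fintype.card_of_bijective (f := fun j => ⟨⟨i, j⟩, rfl⟩) ⟨fun j j' h => ?_, ?_⟩).symm
  · simpa using h
  · rintro ⟨⟨i, j⟩, rfl⟩
    exact ⟨j, rfl⟩

theorem card_bottom (T : Tabloid n μ) : T.bottom.card = μ 1 := by
  obtain ⟨t, rfl⟩ := T.exists_toTabloid_eq
  rw [← card_fiber_fst (μ := μ) 1, ← Fintype.card_coe]
  exact Fintype.card_congr (Equiv.subtypeEquiv (Equiv.symm t) fun x => mem_bottom)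

theorem exists_bottom_eq (h : μ 0 + μ 1 = n) {A : Finset (Fin n)} (hA : A.card = μ 1) :
    ∃ T : Tabloid n μ, T.bottom = A := by
  obtain ⟨t, ht⟩ := exists_equiv_of_card_fiber (fun c : Σ i : Fin 2, Fin (μ i) => c.1)
    (fun x : Fin n => if x ∈ A then 1 else 0) fun i => by
      rw [card_fiber_fst, Fintype.card_subtype]
      fin_cases i
      · have := Finset.card_compl A
        rw [Fintype.card_fin] at this
        simp only [Fin.zero_eta]
        rw [show (Finset.univ.filter fun x => (if x ∈ A then (1 : Fin 2) else 0) = 0) = Aᶜ by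
          ext; simp]
        omega
      · simp [hA]
  refine ⟨Tableau.toTabloid t, Finset.ext fun x => mem_bottom.trans ?_⟩
  have := ht (t.symm x)
  rw [t.apply_symm_apply] at this
  change (t.symm x).1 = 1 ↔ _
  rw [← this]
  simp

instance : Finite (Tabloid n μ) := Finite.of_injective _ bottom_injective

instance : DecidableEq (Tabloid n μ) := bottom_injective.decidableEq

noncomputable instance : Fintype (Tabloid n μ) := Fintype.ofFinite _

/-- Tabloids with two rows correspond to subsets. -/
noncomputable def equivPowersetCard (h : μ 0 + μ 1 = n) : Tabloid n μ ≃ Set.powersetCard (Fin n) (μ 1) :=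
  Equiv.ofBijective (fun T => ⟨T.bottom, T.card_bottom⟩)
    ⟨fun _ _ hT => bottom_injective (congrArg Subtype.val hT),
      fun A => (exists_bottom_eq h A.2).imp fun _ hT => Subtype.ext hT⟩

end Tabloid

theorem youngCharacter_eq {n : ℕ} {μ : Fin 2 → ℕ} (h : μ 0 + μ 1 = n) :
    youngCharacter n μ =
      fun g => (Nat.card (fixedBy (Set.powersetCard (Fin n) (μ 1)) g) : ℂ) := by
  funext g
  rw [youngCharacter, youngModule, character_ofMulAction,
    card_fixedBy_congr (Tabloid.equivPowersetCard h) fun g T => Subtype.ext (T.bottom_smul g)]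

/-! ### Splitting two-row Young modules -/

section Specht

variable {n : ℕ} {μ : Fin 2 → ℕ}

open MonoidAlgebra (single)

theorem Tableau.col_injOn {t : Tableau n μ} {s : Set (Fin n)} (i : Fin 2)
    (hs : ∀ x ∈ s, t.row x = i) : Set.InjOn t.col s := fun x hx y hy h => by
  have hrow : (Equiv.symm t x).1 = (Equiv.symm t y).1 := (hs x hx).trans (hs y hy).symm
  refine (Equiv.symm t).injective (Sigma.ext hrow ?_)
  exact (Fin.heq_ext_iff (congrArg μ hrow)).2 h

theorem youngModule_apply_polytabloid (g : Equiv.Perm (Fin n)) (t : Tableau n μ) :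
    youngModule n μ g t.polytabloid = ∑ π with π ∈ t.columnStabilizer,
      ((Equiv.Perm.sign π : ℤ) : ℂ) • single (g • π • t.toTabloid) (1 : ℂ) := by
  rw [Tableau.polytabloid, map_sum, ← Finset.sum_subtype_eq_sum_filter]
  simp [youngModule, smul_toTabloid]

/-- The Specht module, together with the sums of the tabloids whose second row contains a given
set with one element less, spans the Young module. -/
theorem spechtModule_sup_eq_top (W : Submodule ℂ (MonoidAlgebra ℂ (Tabloid n μ)))
    (hW : ∀ C : Finset (Fin n), C.card + 1 = μ 1 →
      ∑ T : Tabloid n μ with C ⊆ T.bottom, single T (1 : ℂ) ∈ W) :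
    (spechtModule n μ).toSubmodule ⊔ W = ⊤ := by
  set R := (spechtModule n μ).toSubmodule ⊔ W with hR
  -- The classes of the tabloids modulo the sum `R`, indexed by second rows. Membership of the
  -- generators of `W` and of the polytabloids in `R` supplies the two vanishing conditions of
  -- `eq_zero_of_signed_sums`.
  let φ : Finset (Fin n) → MonoidAlgebra ℂ (Tabloid n μ) ⧸ R :=
    Function.extend Tabloid.bottom (fun T => R.mkQ (single T 1)) 0
  have hφb : ∀ T : Tabloid n μ, φ T.bottom = R.mkQ (single T 1) :=
    Tabloid.bottom_injective.extend_apply _ _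
  have hφ : ∀ B, B.card ≠ μ 1 → φ B = 0 := fun B hB =>
    Function.extend_apply' _ _ _ (by rintro ⟨T, rfl⟩; exact hB T.card_bottom)
  have h := sum_superset_eq_zero hφ fun C hC => by
    rw [sum_extend Tabloid.bottom_injective, ← map_sum]
    exact (Submodule.Quotient.mk_eq_zero R).2 (Submodule.mem_sup_right (hW C hC))
  have hsingle : ∀ T : Tabloid n μ, single T (1 : ℂ) ∈ R := fun T => by
    obtain ⟨t, rfl⟩ := T.exists_toTabloid_eq
    rw [← Submodule.Quotient.mk_eq_zero R, ← Submodule.mkQ_apply, ← hφb]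
    refine eq_zero_of_signed_sums hφ h (Tabloid.card_bottom _)
      (Finset.univ.filter (· ∈ t.columnStabilizer)) (by simp [one_mem]) (fun π hπ => ?_)
      fun g => ?_
    · refine sign_eq_of_preserves_columns (col := t.col) (t.col_injOn 1 fun x hx => ?_)
        (t.col_injOn 0 fun x hx => ?_) (Finset.mem_filter.1 hπ).2
      · exact Tabloid.mem_bottom.1 hx
      · have : t.row x ≠ 1 := fun hx' => by
          simp [Tabloid.mem_bottom, hx'] at hx
        omega
    · simp only [← Tabloid.bottom_smul, hφb, ← map_smul, ← map_sum]
      rw [← youngModule_apply_polytabloid, youngModule_polytabloid]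
      exact (Submodule.Quotient.mk_eq_zero R).2
        (Submodule.mem_sup_left (Submodule.subset_span ⟨_, rfl⟩))
  refine eq_top_iff.2 fun v _ => ?_
  induction v using MonoidAlgebra.induction_linear with
  | zero => exact zero_mem _
  | add v w hv hw => exact add_mem (hv trivial) (hw trivial)
  | single T c => simpa using R.smul_mem c (hsingle T)

/-- Elements of the Specht module are annihilated by the maps to Young modules with a shorter
second row. -/
theorem sum_coeff_eq_zero_of_mem_spechtModule (h01 : μ 1 ≤ μ 0) {C : Finset (Fin n)}
    (hC : C.card < μ 1) {v : MonoidAlgebra ℂ (Tabloid n μ)}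
    (hv : v ∈ (spechtModule n μ).toSubmodule) :
    ∑ T : Tabloid n μ with C ⊆ T.bottom, v.coeff T = 0 := by
  induction hv using Submodule.span_induction with
  | zero => simp
  | add v w _ _ hv hw => simp [Finset.sum_add_distrib, hv, hw]
  | smul c v _ hv => simp [← Finset.mul_sum, hv]
  | mem v hv =>
    obtain ⟨t, rfl⟩ := hv
    -- Since `C` has fewer than `μ 1` elements, one of the columns of length two contains no entry
    -- of `C`. Swapping its two entries fixes `C` pointwise and reverses signs, which pairs off the
    -- terms of the sum.
    obtain ⟨j, hj, hjC⟩ : ∃ j ∈ Finset.range (μ 1), j ∉ C.image t.col := by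
      by_contra! hcon
      have := (Finset.card_le_card (show Finset.range (μ 1) ⊆ _ from hcon)).trans
        Finset.card_image_le
      rw [Finset.card_range] at this
      omega
    rw [Finset.mem_range] at hj
    let x : Fin n := t.toFun ⟨0, ⟨j, by omega⟩⟩
    let y : Fin n := t.toFun ⟨1, ⟨j, hj⟩⟩
    have hx : t.col x = j := by simp [x, Tableau.col]; erw [Equiv.symm_apply_apply]
    have hy : t.col y = j := by simp [y, Tableau.col]; erw [Equiv.symm_apply_apply]
    have hxy : x ≠ y := fun h => by
      have := (Equiv.injective t) h
      simp at this
    have hsw : Equiv.swap x y ∈ t.columnStabilizer := fun z => by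
      by_cases hzx : z = x
      · rw [hzx, Equiv.swap_apply_left, hx, hy]
      by_cases hzy : z = y
      · rw [hzy, Equiv.swap_apply_right, hx, hy]
      rw [Equiv.swap_apply_of_ne_of_ne hzx hzy]
    have hCfix : ∀ z ∈ C, Equiv.swap x y z = z := fun z hz =>
      Equiv.swap_apply_of_ne_of_ne
        (fun h => hjC (Finset.mem_image.2 ⟨z, hz, by rw [h, hx]⟩))
        (fun h => hjC (Finset.mem_image.2 ⟨z, hz, by rw [h, hy]⟩))
    have hCsub : ∀ B : Finset (Fin n), C ⊆ Equiv.swap x y • B ↔ C ⊆ B := fun B => by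
      refine forall₂_congr fun z hz => ?_
      rw [← Finset.inv_smul_mem_iff, Equiv.swap_inv, Equiv.Perm.smul_def, hCfix z hz]
    have hpoly := youngModule_apply_polytabloid 1 t
    rw [map_one, Module.End.one_apply] at hpoly
    have hcoef : ∀ T, t.polytabloid.coeff T = ∑ π with π ∈ t.columnStabilizer,
        if π • t.toTabloid = T then ((Equiv.Perm.sign π : ℤ) : ℂ) else 0 := fun T => by
      rw [hpoly]
      simp [Finsupp.single_apply, MonoidAlgebra.coeff_sum]
    simp only [hcoef]
    rw [Finset.sum_comm]
    have hin : ∀ π : Equiv.Perm (Fin n), ∑ T : Tabloid n μ with C ⊆ T.bottom,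
        (if π • t.toTabloid = T then ((Equiv.Perm.sign π : ℤ) : ℂ) else 0) =
        if C ⊆ π • t.toTabloid.bottom then ((Equiv.Perm.sign π : ℤ) : ℂ) else 0 := fun π => by
      rw [Finset.sum_ite_eq]
      simp [Tabloid.bottom_smul]
    simp only [hin]
    refine Finset.sum_involution (fun π _ => Equiv.swap x y * π) ?_ ?_ ?_ ?_
    · intro π _
      rw [mul_smul, Equiv.Perm.sign_mul, Equiv.Perm.sign_swap hxy]
      simp only [hCsub]
      split_ifs <;> simp
    · intro π _ _ heq
      have := mul_eq_right.1 heq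
      exact hxy (Equiv.swap_eq_one_iff.1 this)
    · intro π hπ
      simp only [Finset.mem_filter, Finset.mem_univ, true_and] at hπ ⊢
      exact mul_mem hsw hπ
    · intro π _
      simp [← mul_assoc]

variable (n μ) in
/-- The map sending a set `C` to the sum of the tabloids whose second row contains `C`. -/
noncomputable def upMap (s : ℕ) :
    MonoidAlgebra ℂ (Set.powersetCard (Fin n) s) →ₗ[ℂ] MonoidAlgebra ℂ (Tabloid n μ) :=
  Finsupp.linearCombination ℂ (fun C : Set.powersetCard (Fin n) s =>
    ∑ T : Tabloid n μ with C.1 ⊆ T.bottom, single T (1 : ℂ)) ∘ₗ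
      (MonoidAlgebra.coeffLinearEquiv ℂ).toLinearMap

theorem upMap_single {s : ℕ} (C : Set.powersetCard (Fin n) s) (c : ℂ) :
    upMap n μ s (single C c) = c • ∑ T : Tabloid n μ with C.1 ⊆ T.bottom, single T (1 : ℂ) := by
  simp [upMap]

theorem coeff_upMap {s : ℕ} (w : MonoidAlgebra ℂ (Set.powersetCard (Fin n) s))
    (T : Tabloid n μ) :
    (upMap n μ s w).coeff T = ∑ C : Set.powersetCard (Fin n) s with C.1 ⊆ T.bottom, w.coeff C := by
  induction w using MonoidAlgebra.induction_linear with
  | zero => simp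
  | add v w hv hw => simp [Finset.sum_add_distrib, hv, hw]
  | single C c =>
    rw [upMap_single]
    simp [MonoidAlgebra.coeff_sum, Finsupp.single_apply]

/-- The coefficient of the image at `T` is the sum of the coefficients over `s`-subsets of
`T.bottom`, and every `(s + 1)`-set is such a second row. The shape gives `2 * s < n`, so
`eq_zero_of_sum_subset` applies. -/
theorem upMap_injective {s : ℕ} (h : μ 0 + μ 1 = n) (h01 : μ 1 ≤ μ 0) (hs : s + 1 = μ 1) :
    Function.Injective (upMap n μ s) := by
  rw [injective_iff_map_eq_zero]
  intro w hw
  have key := eq_zero_of_sum_subset (s := s)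
    (φ := Function.extend (Subtype.val : Set.powersetCard (Fin n) s → _) w.coeff 0)
    (by rw [Fintype.card_fin]; omega)
    (fun B hB => Function.extend_apply' _ _ _ (by rintro ⟨C, rfl⟩; exact hB C.2))
    fun B hB => by
      obtain ⟨T, rfl⟩ := Tabloid.exists_bottom_eq h (hB.trans hs)
      rw [sum_extend Subtype.val_injective, ← coeff_upMap, hw]
      simp
  refine MonoidAlgebra.ext (Finsupp.ext fun C => ?_)
  have := congrFun key C.1
  rwa [Subtype.val_injective.extend_apply] at this

theorem upMap_ofMulAction {s : ℕ} (g : Equiv.Perm (Fin n))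
    (w : MonoidAlgebra ℂ (Set.powersetCard (Fin n) s)) :
    upMap n μ s (Representation.ofMulAction ℂ _ _ g w) = youngModule n μ g (upMap n μ s w) := by
  induction w using MonoidAlgebra.induction_linear with
  | zero => simp
  | add v w hv hw => simp [hv, hw]
  | single C c =>
    rw [Representation.ofMulAction_single, upMap_single, upMap_single, map_smul, map_sum]
    congr 1
    simp only [youngModule, Representation.ofMulAction_single]
    refine (Finset.sum_bij' (fun T _ => g • T) (fun T _ => g⁻¹ • T) ?_ ?_ ?_ ?_ ?_).symm <;>
      simp [Tabloid.bottom_smul, Finset.smul_finset_subset_iff]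

/-- The Specht module is orthogonal to the range, since pairing with the image of `C` is the sum
that `sum_coeff_eq_zero_of_mem_spechtModule` annihilates. A vector in both is therefore orthogonal
to itself. Spanning is `spechtModule_sup_eq_top`. -/
theorem isCompl_spechtModule {s : ℕ} (h01 : μ 1 ≤ μ 0) (hs : s + 1 = μ 1) :
    IsCompl (spechtModule n μ).toSubmodule (LinearMap.range (upMap n μ s)) := by
  refine ⟨Submodule.disjoint_def.2 ?_, codisjoint_iff.2 (spechtModule_sup_eq_top _ ?_)⟩
  · rintro v hv ⟨w, hw⟩
    have hcoeff := coeff_upMap (μ := μ) w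
    rw [hw] at hcoeff
    have hsum : ∑ T : Tabloid n μ, v.coeff T * star (v.coeff T) = 0 := by
      calc ∑ T : Tabloid n μ, v.coeff T * star (v.coeff T)
          = ∑ T : Tabloid n μ, ∑ C : Set.powersetCard (Fin n) s,
              if C.1 ⊆ T.bottom then w.coeff C * star (v.coeff T) else 0 :=
            Finset.sum_congr rfl fun T _ => by
              rw [← Finset.sum_filter, ← Finset.sum_mul, ← hcoeff T]
        _ = ∑ C : Set.powersetCard (Fin n) s, w.coeff C *
              star (∑ T : Tabloid n μ with C.1 ⊆ T.bottom, v.coeff T) := by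
            rw [Finset.sum_comm]
            simp only [← Finset.sum_filter, ← Finset.mul_sum, ← star_sum]
        _ = 0 := Finset.sum_eq_zero fun C _ => by
            have hC : C.1.card = s := C.2
            rw [sum_coeff_eq_zero_of_mem_spechtModule h01 (by omega) hv, star_zero, mul_zero]
    have hzero : (fun T => v.coeff T) = 0 := by
      open scoped ComplexOrder in exact dotProduct_self_star_eq_zero.1 hsum
    exact MonoidAlgebra.ext (Finsupp.ext fun T => congrFun hzero T)
  · intro C hC
    refine ⟨single ⟨C, by rw [Set.powersetCard.mem_iff]; omega⟩ 1, ?_⟩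
    rw [upMap_single, one_smul]

theorem spechtCharacter_eq_sub {s : ℕ} (h : μ 0 + μ 1 = n) (h01 : μ 1 ≤ μ 0)
    (hs : s + 1 = μ 1) :
    spechtCharacter n μ = youngCharacter n μ -
      fun g => (Nat.card (fixedBy (Set.powersetCard (Fin n) s) g) : ℂ) := by
  funext g
  rw [Pi.sub_apply, youngCharacter, character_eq_add_of_isCompl (spechtModule n μ)
    (Representation.ofMulAction ℂ _ (Set.powersetCard (Fin n) s)) (upMap n μ s)
    (upMap_injective h h01 hs) upMap_ofMulAction (isCompl_spechtModule h01 hs),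
    character_ofMulAction, add_sub_cancel_right]
  rfl

/-- With an empty second row no set has one element less, so the spanning result holds with nothing
added to the Specht module. -/
theorem spechtCharacter_eq_youngCharacter (h1 : μ 1 = 0) :
    spechtCharacter n μ = youngCharacter n μ := by
  funext g
  have htop : (spechtModule n μ).toSubmodule = ⊤ := by
    have := spechtModule_sup_eq_top (n := n) (μ := μ) ⊥ fun C hC => by omega
    rwa [sup_bot_eq] at this
  rw [youngCharacter, Representation.character,
    ← LinearMap.trace_conj' _ (LinearEquiv.ofTop _ htop).symm]
  rfl

end Specht

end Foulkes
-- Multiplicities in Foulkes characters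
namespace Foulkes

open MulAction

theorem charInner_foulkesCharacter {n a b : ℕ} (r : ℕ) (ha : 0 < a) (hn : n = a * b) :
    charInner (foulkesCharacter n a b)
      (fun g => (Nat.card (fixedBy (Set.powersetCard (Fin n) r) g) : ℂ)) =
        (boxPartitions r a b).card := by
  have h : foulkesCharacter n a b = fun g => (Nat.card (fixedBy (SetPartition n a b) g) : ℂ) :=
    funext fun g => character_ofMulAction g
  rw [h, charInner_card_fixedBy, SetPartition.card_orbits ha hn]

theorem charInner_foulkesCharacter_youngCharacter {n a b r : ℕ} (ha : 0 < a) (hn : n = a * b)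
    (hr : r ≤ n) :
    charInner (foulkesCharacter n a b) (youngCharacter n ![n - r, r]) =
      (boxPartitions r a b).card := by
  rw [youngCharacter_eq (by simp; omega), ← charInner_foulkesCharacter r ha hn]
  rfl

theorem charInner_foulkesCharacter_spechtCharacter {n a b r : ℕ} (ha : 0 < a) (hn : n = a * b)
    (hr : 2 * r ≤ n) :
    charInner (foulkesCharacter n a b) (spechtCharacter n ![n - r, r]) =
      (boxPartitions r a b).card -
        (if r = 0 then 0 else ((boxPartitions (r - 1) a b).card : ℂ)) := by
  -- The case `r = 0` encodes that there are no partitions of `-1`; truncated subtraction would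
  -- instead count the empty partition of `0`.
  split_ifs with h0
  · rw [spechtCharacter_eq_youngCharacter (by simpa using h0),
      charInner_foulkesCharacter_youngCharacter ha hn (by omega), sub_zero]
  · rw [spechtCharacter_eq_sub (s := r - 1) (by simp; omega) (by simp; omega) (by simp; omega),
      charInner_sub_right, charInner_foulkesCharacter_youngCharacter ha hn (by omega),
      charInner_foulkesCharacter _ ha hn]

end Foulkes

theorem corollary2p6 (a b r : ℕ) (ha : 0 < a) (hb : 0 < b) :
    (r ≤ a * b →
      Foulkes.charInner (Foulkes.foulkesCharacter (a * b) a b)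
          (Foulkes.youngCharacter (a * b) ![a * b - r, r]) =
        ((Foulkes.boxPartitions r a b).card : ℂ) ∧
      Foulkes.charInner (Foulkes.foulkesCharacter (a * b) b a)
          (Foulkes.youngCharacter (a * b) ![a * b - r, r]) =
        ((Foulkes.boxPartitions r a b).card : ℂ)) ∧
    (2 * r ≤ a * b →
      Foulkes.charInner (Foulkes.foulkesCharacter (a * b) a b)
          (Foulkes.spechtCharacter (a * b) ![a * b - r, r]) =
        ((Foulkes.boxPartitions r a b).card : ℂ) -
          (if r = 0 then 0 else ((Foulkes.boxPartitions (r - 1) a b).card : ℂ)) ∧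
      Foulkes.charInner (Foulkes.foulkesCharacter (a * b) b a)
          (Foulkes.spechtCharacter (a * b) ![a * b - r, r]) =
        ((Foulkes.boxPartitions r a b).card : ℂ) -
          (if r = 0 then 0 else ((Foulkes.boxPartitions (r - 1) a b).card : ℂ))) := by
  have hba : a * b = b * a := mul_comm a b
  refine ⟨fun hr => ⟨?_, ?_⟩, fun hr => ⟨?_, ?_⟩⟩
  · exact Foulkes.charInner_foulkesCharacter_youngCharacter ha rfl hr
  · rw [Foulkes.charInner_foulkesCharacter_youngCharacter hb hba hr,
      Foulkes.card_boxPartitions_comm]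
  · exact Foulkes.charInner_foulkesCharacter_spechtCharacter ha rfl hr
  · rw [Foulkes.charInner_foulkesCharacter_spechtCharacter hb hba hr,
      Foulkes.card_boxPartitions_comm r, Foulkes.card_boxPartitions_comm (r - 1)]
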